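/- There is a universal constant $C>0$ such that, for every integer $n\ge 3$, the shortest path polytope on the complete graph $K_n$ has a monotone path of length greater than $\frac{C}{n^2}\sqrt[3]{n!}$. Here the shortest path polytope on $K_n$ is the convex hull, in the space with one coordinate $x_{i,j}$ for each ordered pair of distinct nodes $i\in\{1,\dots,n-1\}$, $j\in\{2,\dots,n\}$, of the $0/1$ incidence vectors of the directed paths from node $1$ to node $n$ in which no node is repeated ($x_{i,j}=1$ if and only if the path goes from $i$ directly to $j$). A monotone path of length $L$ on a polytope $P$ is a sequence $v_0,v_1,\dots,v_L$ of vertices of $P$ such that, for some linear objective function $c$ taking distinct values at distinct vertices of $P$, each segment $[v_{k},v_{k+1}]$ $(0\le k<L)$ is an edge of $P$ with $c(v_{k+1})<c(v_k)$, and $v_L$ is the minimizer of $c$ over $P$. -/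

import Mathlib

/-!
# Monotone paths on the shortest path polytope
-/

/-- `v` and `w` are the two endpoints of an edge (one-dimensional face) of the polytope `P`:
they are distinct vertices and the segment joining them is a face of `P`, i.e. the set of
maximizers over `P` of some linear functional. -/
def PolytopeAdj {E : Type*} [AddCommGroup E] [Module ℝ E] [TopologicalSpace E]
    (P : Set E) (v w : E) : Prop :=
  v ∈ P.extremePoints ℝ ∧ w ∈ P.extremePoints ℝ ∧ v ≠ w ∧ IsExposed ℝ P (segment ℝ v w)

/-- The linear objective function `c` is nondegenerate on `P`: no two vertices of `P` have the
same objective value. -/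
def IsNondegenerateObjective {E : Type*} [AddCommGroup E] [Module ℝ E]
    (P : Set E) (c : E →ₗ[ℝ] ℝ) : Prop :=
  Set.InjOn c (P.extremePoints ℝ)

/-- `v 0, v 1, …, v L` is a `c`-monotone path of length `L` on `P`, for the problem of minimizing
`c` over `P`: a sequence of vertices of `P` in which consecutive vertices are joined by an edge
of `P` along which `c` strictly decreases, and which ends at the optimal vertex. -/
structure IsMonotonePath {E : Type*} [AddCommGroup E] [Module ℝ E] [TopologicalSpace E]
    (P : Set E) (c : E →ₗ[ℝ] ℝ) (L : ℕ) (v : Fin (L + 1) → E) : Prop where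
  vertex : ∀ i, v i ∈ P.extremePoints ℝ
  adj : ∀ i : Fin L, PolytopeAdj P (v i.castSucc) (v i.succ)
  decreasing : ∀ i : Fin L, c (v i.succ) < c (v i.castSucc)
  optimal : ∀ x ∈ P, c (v (Fin.last L)) ≤ c x

/-- The coordinates of the shortest path polytope from `s` to `t` on the complete graph with node
set `V`: the ordered pairs `(i, j)` of distinct nodes with `i ≠ t` and `j ≠ s`. -/
abbrev PathArc {V : Type*} (s t : V) : Type _ :=
  {a : V × V // a.1 ≠ a.2 ∧ a.1 ≠ t ∧ a.2 ≠ s}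

/-- The `0/1` incidence vector of a walk from `s` to `t` in the complete graph: the coordinate
`(i, j)` is `1` if the walk goes through the edge from `i` to `j` in this direction, and `0`
otherwise. -/
noncomputable def pathVector {V : Type*} {s t : V} (p : (⊤ : SimpleGraph V).Walk s t) :
    PathArc s t → ℝ :=
  Set.indicator {a | ∃ d ∈ p.darts, d.toProd = a.1} 1

/-- The shortest path polytope from `s` to `t` on the complete graph with node set `V`: the convex
hull of the incidence vectors of the paths from `s` to `t` without repeated nodes. -/
def shortestPathPolytope {V : Type*} (s t : V) : Set (PathArc s t → ℝ) :=
  convexHull ℝ {x | ∃ p : (⊤ : SimpleGraph V).Walk s t, p.IsPath ∧ x = pathVector p}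

/-! Two paths whose union carries no third path span an edge of the polytope: minus the sum of the
coordinates off the union is maximized exactly on their segment (`isExposed_segment`). In
particular, paths that share a prefix up to a node `b` and then reach `t` through disjoint sets of
nodes are adjacent (`polytopeAdj_of_diverge`). A monotone path may therefore exchange a tail for any
cheaper disjoint tail.

Such exchanges can be made to run like an odometer. Take hubs `U k = s, …, U 0` and a set `A` of
other nodes, and consider paths alternating between hubs and nodes of `A`. After the hub `U (l + 1)`
the next node runs through the unused part of `A` in increasing order. For each choice `a` a full
traversal of level `l` is performed; it ends in the short tail `a, U l, t`, which a single exchange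
replaces by `b, t` for the next node `b` (`HasLongChains.loop`). Weights whose scale grows
geometrically with the level make every exchange improving, and a very cheap arc from `s` to `t`
makes the final path optimal.

With `m = n - 2 - k` nodes in `A` this gives at least `m (m - 1) ⋯ (m - k + 1)` steps. For `k` near
`n / 3` this is at least `(2k)! / k!`, whose cube is at least `(3k)!`, and passing from `(3k)!` to
`n!` costs at most a factor `n ^ 2` after the cube root. -/

/-! ### Arcs of a list of nodes -/

/-- The list of pairs of consecutive entries of a list. -/
def List.arcs {V : Type*} : List V → List (V × V)
  | x :: y :: l => (x, y) :: List.arcs (y :: l)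
  | _ => []

section Arcs

variable {V : Type*}

@[simp] lemma List.arcs_nil : ([] : List V).arcs = [] := rfl
@[simp] lemma List.arcs_singleton (x : V) : [x].arcs = [] := rfl
@[simp] lemma List.arcs_cons_cons (x y : V) (l : List V) :
    (x :: y :: l).arcs = (x, y) :: (y :: l).arcs := rfl

lemma List.arcs_append_cons (p : List V) (b : V) (q : List V) :
    (p ++ b :: q).arcs = (p ++ [b]).arcs ++ (b :: q).arcs := by
  induction p with
  | nil => simp
  | cons x p ih => cases p with
    | nil => simp
    | cons y p => simpa using ih

lemma List.fst_mem_of_mem_arcs {l : List V} {e : V × V} (h : e ∈ l.arcs) : e.1 ∈ l := by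
  induction l with
  | nil => simp at h
  | cons x l ih => cases l with
    | nil => simp at h
    | cons y l =>
      rw [List.arcs_cons_cons, List.mem_cons] at h
      rcases h with rfl | h
      · simp
      · exact List.mem_cons_of_mem _ (ih h)

lemma List.snd_mem_tail_of_mem_arcs {l : List V} {e : V × V} (h : e ∈ l.arcs) :
    e.2 ∈ l.tail := by
  induction l with
  | nil => simp at h
  | cons x l ih => cases l with
    | nil => simp at h
    | cons y l =>
      rw [List.arcs_cons_cons, List.mem_cons] at h
      rcases h with rfl | h
      · simp
      · exact List.mem_cons_of_mem _ (ih h)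

lemma List.fst_mem_of_mem_arcs_concat {l : List V} {t : V} {e : V × V}
    (h : e ∈ (l ++ [t]).arcs) : e.1 ∈ l := by
  induction l with
  | nil => simp at h
  | cons x l ih => cases l with
    | nil => simp at h; simp [h]
    | cons y l =>
      simp only [List.cons_append, List.arcs_cons_cons, List.mem_cons] at h
      rcases h with rfl | h
      · simp
      · exact List.mem_cons_of_mem _ (ih (by simpa using h))

lemma List.Nodup.fst_ne_snd_of_mem_arcs {l : List V} (hl : l.Nodup) {e : V × V}
    (h : e ∈ l.arcs) : e.1 ≠ e.2 := by
  induction l with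
  | nil => simp at h
  | cons x l ih => cases l with
    | nil => simp at h
    | cons y l =>
      rw [List.arcs_cons_cons, List.mem_cons] at h
      rcases h with rfl | h
      · intro hxy
        simp at hxy
        simp [hxy] at hl
      · exact ih hl.of_cons h

lemma List.Nodup.arcs {l : List V} (hl : l.Nodup) : l.arcs.Nodup := by
  induction l with
  | nil => simp
  | cons x l ih => cases l with
    | nil => simp
    | cons y l =>
      rw [List.arcs_cons_cons, List.nodup_cons]
      refine ⟨fun h => ?_, ih hl.of_cons⟩
      exact (List.nodup_cons.1 hl).1 (List.fst_mem_of_mem_arcs h)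

lemma List.Nodup.arcs_functional {l : List V} (hl : l.Nodup) {x y z : V}
    (hy : (x, y) ∈ l.arcs) (hz : (x, z) ∈ l.arcs) : y = z := by
  induction l with
  | nil => simp at hy
  | cons a l ih => cases l with
    | nil => simp at hy
    | cons b l =>
      have ha := (List.nodup_cons.1 hl).1
      rw [List.arcs_cons_cons, List.mem_cons, Prod.mk.injEq] at hy hz
      rcases hy with ⟨rfl, rfl⟩ | hy <;> rcases hz with ⟨h1, rfl⟩ | hz
      · rfl
      · exact absurd (List.fst_mem_of_mem_arcs hz) ha
      · exact absurd (h1 ▸ List.fst_mem_of_mem_arcs hy) ha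
      · exact ih hl.of_cons hy hz

lemma List.length_arcs_le (l : List V) : l.arcs.length ≤ l.length := by
  induction l with
  | nil => simp
  | cons x l ih => cases l with
    | nil => simp
    | cons y l => simpa using ih

/-- A list of distinct nodes from `s` to `t`. -/
structure IsPathList (s t : V) (l : List V) : Prop where
  nodup : l.Nodup
  head : l.head? = some s
  last : l.getLast? = some t

lemma isPathList_cons {s t x : V} {l : List V} (h : IsPathList s t (s :: x :: l)) :
    IsPathList x t (x :: l) :=
  ⟨h.nodup.of_cons, rfl, by simpa using h.last⟩

lemma IsPathList.eq_singleton {t : V} {l : List V} (h : IsPathList t t l) : l = [t] := by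
  obtain ⟨h1, h2, h3⟩ := h
  cases l with
  | nil => simp at h2
  | cons x l =>
    obtain rfl : x = t := by simpa using h2
    cases l with
    | nil => rfl
    | cons y l =>
      refine absurd ?_ (List.nodup_cons.1 h1).1
      rw [List.getLast?_cons_cons] at h3
      exact List.mem_of_getLast? h3

/-- A path all of whose arcs lie in a relation that is functional along another path with the same
ends equals that path. -/
lemma IsPathList.eq_of_arcs {E : V → V → Prop} {s t : V} {q l : List V}
    (hq : IsPathList s t q) (hl : IsPathList s t l)
    (hE : ∀ x y z, (x, y) ∈ q.arcs → E x z → z = y) (h : ∀ e ∈ l.arcs, E e.1 e.2) : l = q := by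
  induction q generalizing s l with
  | nil => simpa using hq.head
  | cons x q ih =>
    obtain rfl : x = s := by simpa using hq.head
    cases q with
    | nil =>
      obtain rfl : x = t := by simpa using hq.last
      exact hl.eq_singleton
    | cons y q =>
      cases l with
      | nil => simpa using hl.head
      | cons x' l =>
        obtain rfl : x' = x := by simpa using hl.head
        cases l with
        | nil =>
          obtain rfl : x' = t := by simpa using hl.last
          exact hq.eq_singleton.symm
        | cons z l =>
          obtain rfl : z = y := hE x' y z (by simp) (h (x', z) (by simp))
          rw [ih (isPathList_cons hq) (isPathList_cons hl)
            (fun a b c hab => hE a b c (by simp [hab])) (fun e he => h e (by simp [he]))]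

/-- If two paths diverge only at the node `b`, their union contains no third path. -/
lemma IsPathList.eq_or_eq_of_arcs {s t b : V} {P Q l : List V}
    (hP : IsPathList s t P) (hQ : IsPathList s t Q) (hl : IsPathList s t l)
    (hb : ∀ x y z, x ≠ b → (x, y) ∈ P.arcs → (x, z) ∈ Q.arcs → y = z)
    (h : ∀ e ∈ l.arcs, e ∈ P.arcs ∨ e ∈ Q.arcs) : l = P ∨ l = Q := by
  -- The arc of `l` leaving `b` decides. If it lies in `P`, every other arc of `l` is in `P` or
  -- leaves a node other than `b`, where `Q` agrees with `P`. Otherwise, also when `l` avoids `b`,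
  -- the roles are exchanged.
  by_cases hc : ∃ y, (b, y) ∈ l.arcs ∧ (b, y) ∈ P.arcs
  · left
    obtain ⟨y, hyl, hyP⟩ := hc
    refine hP.eq_of_arcs hl
      (E := fun x z => (x, z) ∈ P.arcs ∨ ((x, z) ∈ Q.arcs ∧ x ≠ b)) ?_ ?_
    · rintro x y z hxy (hz | ⟨hz, hx⟩)
      · exact hP.nodup.arcs_functional hz hxy
      · exact (hb x y z hx hxy hz).symm
    · rintro ⟨x, z⟩ he
      by_cases hx : x = b
      · subst hx
        rw [hl.nodup.arcs_functional he hyl]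
        exact Or.inl hyP
      · exact (h _ he).imp id fun h => ⟨h, hx⟩
  · right
    refine hQ.eq_of_arcs hl
      (E := fun x z => (x, z) ∈ Q.arcs ∨ ((x, z) ∈ P.arcs ∧ x ≠ b)) ?_ ?_
    · rintro x y z hxy (hz | ⟨hz, hx⟩)
      · exact hQ.nodup.arcs_functional hz hxy
      · exact hb x z y hx hz hxy
    · rintro ⟨x, z⟩ he
      rcases h _ he with h | h
      · refine Or.inr ⟨h, ?_⟩
        rintro rfl
        exact hc ⟨z, he, h⟩
      · exact Or.inl h

/-- Since `p`, `α`, `β` are pairwise disjoint, a node other than `b` that both paths leave lies on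
the common prefix. -/
lemma arcs_diverge {t b : V} {p α β : List V} (h : (p ++ b :: (α ++ (β ++ [t]))).Nodup)
    {x y z : V} (hx : x ≠ b) (hy : (x, y) ∈ (p ++ b :: (α ++ [t])).arcs)
    (hz : (x, z) ∈ (p ++ b :: (β ++ [t])).arcs) : y = z := by
  rw [List.arcs_append_cons, List.mem_append] at hy hz
  rw [← List.cons_append] at hy hz
  simp only [List.nodup_append, List.nodup_cons, List.mem_append, List.mem_cons] at h
  have key1 : ∀ {γ : List V} {w : V}, (x, w) ∈ (b :: γ ++ [t]).arcs → x ∈ γ := by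
    intro γ w hw
    have := List.fst_mem_of_mem_arcs_concat hw
    simpa [hx] using this
  have key2 : ∀ {w : V}, (x, w) ∈ (p ++ [b]).arcs → x ∈ p :=
    fun hw => List.fst_mem_of_mem_arcs_concat hw
  rcases hy with hy | hy <;> rcases hz with hz | hz
  · refine List.Nodup.arcs_functional (l := p ++ [b]) ?_ hy hz
    simp only [List.nodup_append, List.nodup_singleton]
    grind
  · have := key2 hy; have := key1 hz; grind
  · have := key1 hy; have := key2 hz; grind
  · have := key1 hy; have := key1 hz; grind

end Arcs

/-! ### Vertices and edges of the shortest path polytope -/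

section Polytope

variable {V : Type*} {s t : V}

/-- The incidence vector of the arcs of a list of nodes. -/
noncomputable def arcVector (s t : V) (l : List V) : PathArc s t → ℝ :=
  Set.indicator {a | a.1 ∈ l.arcs} 1

lemma arcVector_of_mem {l : List V} {a : PathArc s t} (h : a.1 ∈ l.arcs) :
    arcVector s t l a = 1 :=
  Set.indicator_of_mem (s := {a : PathArc s t | a.1 ∈ l.arcs}) h 1

lemma arcVector_of_notMem {l : List V} {a : PathArc s t} (h : a.1 ∉ l.arcs) :
    arcVector s t l a = 0 :=
  Set.indicator_of_notMem (s := {a : PathArc s t | a.1 ∈ l.arcs}) h 1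

lemma map_toProd_darts {G : SimpleGraph V} {u v : V} (p : G.Walk u v) :
    p.darts.map (fun d => d.toProd) = p.support.arcs := by
  induction p with
  | nil => simp
  | cons h p ih => cases p <;> simp_all

lemma pathVector_eq (p : (⊤ : SimpleGraph V).Walk s t) :
    pathVector p = arcVector s t p.support := by
  simp [pathVector, arcVector, ← map_toProd_darts]

lemma exists_walk_support_eq {l : List V} {s t : V} (h : IsPathList s t l) :
    ∃ p : (⊤ : SimpleGraph V).Walk s t, p.support = l := by
  induction l generalizing s with
  | nil => simpa using h.head
  | cons x l ih =>
    obtain rfl : x = s := by simpa using h.head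
    cases l with
    | nil =>
      obtain rfl : x = t := by simpa using h.last
      exact ⟨.nil, rfl⟩
    | cons y l =>
      obtain ⟨p, hp⟩ := ih (isPathList_cons h)
      have hxy : x ≠ y := h.nodup.fst_ne_snd_of_mem_arcs (e := (x, y)) (by simp)
      exact ⟨.cons (by simpa using hxy) p, by simp [hp]⟩

lemma shortestPathPolytope_eq (s t : V) :
    shortestPathPolytope s t = convexHull ℝ (arcVector s t '' {l | IsPathList s t l}) := by
  unfold shortestPathPolytope
  congr 1
  ext x
  constructor
  · rintro ⟨p, hp, rfl⟩
    refine ⟨p.support, ⟨hp.support_nodup, ?_, ?_⟩, (pathVector_eq p).symm⟩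
    · rw [List.head?_eq_some_head p.support_ne_nil, p.head_support]
    · rw [List.getLast?_eq_some_getLast p.support_ne_nil, p.getLast_support]
  · rintro ⟨l, hl, rfl⟩
    obtain ⟨p, rfl⟩ := exists_walk_support_eq hl
    exact ⟨p, .mk' hl.nodup, (pathVector_eq p).symm⟩

lemma IsPathList.arc_valid {l : List V} (hl : IsPathList s t l) {e : V × V} (he : e ∈ l.arcs) :
    e.1 ≠ e.2 ∧ e.1 ≠ t ∧ e.2 ≠ s := by
  obtain ⟨h1, h2, h3⟩ := hl
  refine ⟨h1.fst_ne_snd_of_mem_arcs he, ?_, ?_⟩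
  · obtain ⟨l', rfl⟩ := List.getLast?_eq_some_iff.1 h3
    have := List.fst_mem_of_mem_arcs_concat he
    rintro rfl
    exact (List.disjoint_of_nodup_append h1) this (by simp)
  · have := List.snd_mem_tail_of_mem_arcs he
    cases l with
    | nil => simp at h2
    | cons x l =>
      obtain rfl : x = s := by simpa using h2
      rintro h
      exact (List.nodup_cons.1 h1).1 (h ▸ this)

/-- The condition `x ∈ F ∨ l x < 0` is itself convex: a proper mixture with a point where `l` is
negative keeps `l` negative. It thus passes from the generators to the hull, which identifies the
face where `l` vanishes. -/
lemma convexHull_subset_union_of_neg {E : Type*} [AddCommGroup E] [Module ℝ E] {S F : Set E}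
    (l : E →ₗ[ℝ] ℝ) (hF : Convex ℝ F) (hF0 : ∀ x ∈ F, l x = 0)
    (hS : ∀ x ∈ S, x ∈ F ∨ l x < 0) : ∀ x ∈ convexHull ℝ S, x ∈ F ∨ l x < 0 := by
  suffices h : convexHull ℝ S ⊆ {x | x ∈ F ∨ l x < 0} from h
  refine convexHull_min hS ?_
  intro x hx y hy a b ha hb hab
  rcases ha.eq_or_lt with rfl | ha
  · obtain rfl : b = 1 := by linarith
    simpa using hy
  rcases hb.eq_or_lt with rfl | hb
  · obtain rfl : a = 1 := by linarith
    simpa using hx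
  rcases hx with hx | hx <;> rcases hy with hy | hy
  · exact Or.inl (hF hx hy ha.le hb.le hab)
  all_goals
    right
    simp only [map_add, map_smul, smul_eq_mul]
    try rw [hF0 _ hx]
    try rw [hF0 _ hy]
    nlinarith [mul_pos ha hb]

open Classical in
/-- If the union of two paths contains no third path, the segment between their incidence vectors
is a face. -/
lemma isExposed_segment [Fintype V] {P Q : List V} (hP : IsPathList s t P) (hQ : IsPathList s t Q)
    (h : ∀ l, IsPathList s t l → (∀ e ∈ l.arcs, e ∈ P.arcs ∨ e ∈ Q.arcs) → l = P ∨ l = Q) :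
    IsExposed ℝ (shortestPathPolytope s t) (segment ℝ (arcVector s t P) (arcVector s t Q)) := by
  intro _
  let W : Finset (PathArc s t) := {a | ¬ (a.1 ∈ P.arcs ∨ a.1 ∈ Q.arcs)}
  -- On incidence vectors `f` is minus the number of arcs outside the union of `P` and `Q`.
  let f : (PathArc s t → ℝ) →L[ℝ] ℝ := -∑ a ∈ W, ContinuousLinearMap.proj a
  have hf : ∀ x, f x = -∑ a ∈ W, x a := fun x => by simp [f]
  have hf0 : ∀ l, (∀ e ∈ l.arcs, e ∈ P.arcs ∨ e ∈ Q.arcs) → f (arcVector s t l) = 0 := by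
    intro l hl
    rw [hf, neg_eq_zero]
    refine Finset.sum_eq_zero fun a ha => ?_
    exact arcVector_of_notMem fun h => (Finset.mem_filter.1 ha).2 (hl _ h)
  have hP0 := hf0 P fun e he => Or.inl he
  have hQ0 := hf0 Q fun e he => Or.inr he
  have hseg : ∀ x ∈ segment ℝ (arcVector s t P) (arcVector s t Q), f x = 0 := by
    rintro x ⟨a, b, -, -, -, rfl⟩
    simp [hP0, hQ0]
  have hneg := convexHull_subset_union_of_neg
    (S := arcVector s t '' {l | IsPathList s t l}) (f : (PathArc s t → ℝ) →ₗ[ℝ] ℝ)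
    (convex_segment (𝕜 := ℝ) (arcVector s t P) (arcVector s t Q)) hseg (by
      rintro _ ⟨l, hl, rfl⟩
      by_cases hc : ∀ e ∈ l.arcs, e ∈ P.arcs ∨ e ∈ Q.arcs
      · left
        rcases h l hl hc with rfl | rfl
        · exact left_mem_segment _ _ _
        · exact right_mem_segment _ _ _
      · right
        push Not at hc
        obtain ⟨e, he, heP, heQ⟩ := hc
        change f _ < 0
        rw [hf, neg_lt_zero]
        refine Finset.sum_pos' (fun a _ => ?_) ⟨⟨e, hl.arc_valid he⟩, by simp [W, heP, heQ], ?_⟩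
        · exact Set.indicator_nonneg (fun _ _ => zero_le_one) _
        · rw [arcVector_of_mem he]
          exact zero_lt_one)
  rw [← shortestPathPolytope_eq] at hneg
  have hsub : segment ℝ (arcVector s t P) (arcVector s t Q) ⊆ shortestPathPolytope s t := by
    rw [shortestPathPolytope_eq]
    exact segment_subset_convexHull ⟨P, hP, rfl⟩ ⟨Q, hQ, rfl⟩
  refine ⟨f, ?_⟩
  ext x
  constructor
  · intro hx
    refine ⟨hsub hx, fun y hy => ?_⟩
    rw [hseg x hx]
    rcases hneg y hy with hy | hy
    · exact (hseg y hy).le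
    · exact hy.le
  · rintro ⟨hx, hmax⟩
    refine (hneg x hx).resolve_right fun hlt => ?_
    have := hmax _ (hsub (left_mem_segment ℝ _ _))
    rw [hP0] at this
    exact absurd hlt this.not_gt

/-- This is the degenerate case `P = Q` of `isExposed_segment`, where the segment is a point. -/
lemma arcVector_mem_extremePoints [Fintype V] {P : List V} (hP : IsPathList s t P) :
    arcVector s t P ∈ (shortestPathPolytope s t).extremePoints ℝ := by
  rw [← isExtreme_singleton, ← segment_same ℝ (arcVector s t P)]
  refine (isExposed_segment hP hP fun l hl h => Or.inl ?_).isExtreme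
  refine hP.eq_of_arcs hl (E := fun x y => (x, y) ∈ P.arcs) ?_ (by simpa using h)
  exact fun x y z hy hz => hP.nodup.arcs_functional hz hy

lemma polytopeAdj_of_diverge [Fintype V] {b : V} {p α β : List V}
    (h : (p ++ b :: (α ++ (β ++ [t]))).Nodup) (hs : (p ++ [b]).head? = some s)
    (hne : arcVector s t (p ++ b :: (α ++ [t])) ≠ arcVector s t (p ++ b :: (β ++ [t]))) :
    PolytopeAdj (shortestPathPolytope s t) (arcVector s t (p ++ b :: (α ++ [t])))
      (arcVector s t (p ++ b :: (β ++ [t]))) := by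
  have hs' : ∀ γ : List V, (p ++ b :: γ).head? = some s := by
    intro γ; cases p <;> simpa using hs
  have hP : IsPathList s t (p ++ b :: (α ++ [t])) := by
    refine ⟨h.sublist (by simp), hs' _, ?_⟩
    rw [← List.cons_append, ← List.append_assoc, List.getLast?_concat]
  have hQ : IsPathList s t (p ++ b :: (β ++ [t])) := by
    refine ⟨h.sublist (by simp), hs' _, ?_⟩
    rw [← List.cons_append, ← List.append_assoc, List.getLast?_concat]
  exact ⟨arcVector_mem_extremePoints hP, arcVector_mem_extremePoints hQ, hne,
    isExposed_segment hP hQ fun l hl hu =>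
      hP.eq_or_eq_of_arcs hQ hl (fun x y z hx hy hz => arcs_diverge h hx hy hz) hu⟩

end Polytope

/-! ### Objective functions from integer weights -/

section Objective

variable {V : Type*} {s t : V}

/-- The total weight of the arcs of a list of nodes. -/
def arcCost (w : V → V → ℤ) (l : List V) : ℤ := (l.arcs.map fun e => w e.1 e.2).sum

@[simp] lemma arcCost_singleton (w : V → V → ℤ) (x : V) : arcCost w [x] = 0 := rfl

@[simp] lemma arcCost_cons_cons (w : V → V → ℤ) (x y : V) (l : List V) :
    arcCost w (x :: y :: l) = w x y + arcCost w (y :: l) := by simp [arcCost]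

lemma arcCost_append_cons (w : V → V → ℤ) (p : List V) (b : V) (q : List V) :
    arcCost w (p ++ b :: q) = arcCost w (p ++ [b]) + arcCost w (b :: q) := by
  rw [arcCost, List.arcs_append_cons, List.map_append, List.sum_append]; rfl

lemma mem_arcs_iff_of_arcVector_eq {P Q : List V} (hP : IsPathList s t P)
    (h : arcVector s t P = arcVector s t Q) {e : V × V} (he : e ∈ P.arcs) : e ∈ Q.arcs := by
  have h1 := congrFun h ⟨e, hP.arc_valid he⟩
  rw [arcVector_of_mem he] at h1
  by_contra h2
  rw [arcVector_of_notMem h2] at h1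
  exact one_ne_zero h1

lemma IsPathList.eq_of_arcVector_eq {P Q : List V} (hP : IsPathList s t P)
    (hQ : IsPathList s t Q) (h : arcVector s t P = arcVector s t Q) : P = Q :=
  hQ.eq_of_arcs hP (E := fun x y => (x, y) ∈ Q.arcs)
    (fun _ _ _ hy hz => hQ.nodup.arcs_functional hz hy)
    fun _ he => mem_arcs_iff_of_arcVector_eq hP h he

open Classical in
/-- Integer weights can be perturbed to a linear objective that separates all paths and agrees
with the strict comparison of weights. -/
lemma exists_objective [Fintype V] (s t : V) (w : V → V → ℤ) :
    ∃ c : (PathArc s t → ℝ) →ₗ[ℝ] ℝ, ∀ P Q, IsPathList s t P → IsPathList s t Q →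
      (arcCost w P < arcCost w Q → c (arcVector s t P) < c (arcVector s t Q)) ∧
      (c (arcVector s t P) = c (arcVector s t Q) → P = Q) := by
  let K := Fintype.card (PathArc s t)
  let idx : PathArc s t ↪ ℕ := (Fintype.equivFin (PathArc s t)).toEmbedding.trans Fin.valEmbedding
  let A : List V → Finset (PathArc s t) := fun l => {a | a.1 ∈ l.arcs}
  let code : List V → ℕ := fun l => ∑ i ∈ (A l).map idx, 2 ^ i
  -- The low part of the objective is the binary code of the arc set. Codes are below `2 ^ K`, so
  -- they cannot reverse a strict comparison of the integer weights, and they are recovered modulo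
  -- `2 ^ K`.
  let c : (PathArc s t → ℝ) →ₗ[ℝ] ℝ :=
    ∑ a, ((2 ^ K * w a.1.1 a.1.2 + 2 ^ idx a : ℤ) : ℝ) • LinearMap.proj a
  have hcode : ∀ l, code l < 2 ^ K := fun l => Nat.geomSum_lt le_rfl fun i hi => by
    obtain ⟨a, -, rfl⟩ := Finset.mem_map.1 hi
    exact (Fintype.equivFin (PathArc s t) a).2
  have hcost : ∀ l, IsPathList s t l → ∑ a ∈ A l, w a.1.1 a.1.2 = arcCost w l := by
    intro l hl
    rw [arcCost, ← List.sum_toFinset _ hl.nodup.arcs]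
    refine Finset.sum_bij (fun a _ => a.1) ?_ ?_ ?_ ?_
    · intro a ha; simpa [A] using ha
    · intro a _ b _ hab; exact Subtype.ext hab
    · intro e he
      have he : e ∈ l.arcs := by simpa using he
      exact ⟨⟨e, hl.arc_valid he⟩, by simpa [A] using he, rfl⟩
    · intros; rfl
  have hc : ∀ l, IsPathList s t l →
      c (arcVector s t l) = ((2 ^ K * arcCost w l + code l : ℤ) : ℝ) := by
    intro l hl
    rw [← hcost l hl]
    simp only [c, code, LinearMap.sum_apply, LinearMap.smul_apply, LinearMap.proj_apply,
      smul_eq_mul, Finset.sum_map, Finset.mul_sum]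
    push_cast
    rw [← Finset.sum_add_distrib, Finset.sum_filter]
    refine Finset.sum_congr rfl fun a _ => ?_
    by_cases ha : a.1 ∈ l.arcs
    · rw [arcVector_of_mem ha, if_pos ha]; simp
    · rw [arcVector_of_notMem ha, if_neg ha]; simp
  refine ⟨c, fun P Q hP hQ => ⟨fun h => ?_, fun h => ?_⟩⟩
  · rw [hc P hP, hc Q hQ, Int.cast_lt]
    have h1 : (code P : ℤ) < 2 ^ K := by exact_mod_cast hcode P
    have h2 : (2 : ℤ) ^ K * (arcCost w P + 1) ≤ 2 ^ K * arcCost w Q :=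
      mul_le_mul_of_nonneg_left h (by positivity)
    have h3 : (0 : ℤ) ≤ code Q := by positivity
    linarith
  · rw [hc P hP, hc Q hQ, Int.cast_inj] at h
    have h1 : (code P : ℤ) < 2 ^ K := by exact_mod_cast hcode P
    have h2 : (code Q : ℤ) < 2 ^ K := by exact_mod_cast hcode Q
    have h3 := congrArg (· % (2 : ℤ) ^ K) h
    simp only [Int.mul_add_emod_self_left] at h3
    rw [Int.emod_eq_of_lt (by positivity) h1, Int.emod_eq_of_lt (by positivity) h2,
      Int.natCast_inj] at h3
    have h4 : A P = A Q := Finset.map_injective idx (Finset.geomSum_injective le_rfl h3)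
    refine hP.eq_of_arcVector_eq hQ ?_
    have h5 : {a : PathArc s t | a.1 ∈ P.arcs} = {a | a.1 ∈ Q.arcs} := by
      ext a
      simpa [A] using Finset.ext_iff.1 h4 a
    rw [arcVector, arcVector, h5]

/-- Two paths joined by an edge of the polytope along which the weight decreases. -/
def ImprovingStep (s t : V) (w : V → V → ℤ) (P Q : List V) : Prop :=
  IsPathList s t P ∧ IsPathList s t Q ∧ arcCost w Q < arcCost w P ∧
    PolytopeAdj (shortestPathPolytope s t) (arcVector s t P) (arcVector s t Q)

lemma improvingStep_of_diverge [Fintype V] {w : V → V → ℤ} {b : V} {p α β : List V}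
    (h : (p ++ b :: (α ++ (β ++ [t]))).Nodup) (hs : (p ++ [b]).head? = some s)
    (hw : arcCost w (b :: (β ++ [t])) < arcCost w (b :: (α ++ [t]))) :
    ImprovingStep s t w (p ++ b :: (α ++ [t])) (p ++ b :: (β ++ [t])) := by
  have hs' : ∀ γ : List V, (p ++ b :: γ).head? = some s := by
    intro γ; cases p <;> simpa using hs
  have hP : IsPathList s t (p ++ b :: (α ++ [t])) := by
    refine ⟨h.sublist (by simp), hs' _, ?_⟩
    rw [← List.cons_append, ← List.append_assoc, List.getLast?_concat]
  have hQ : IsPathList s t (p ++ b :: (β ++ [t])) := by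
    refine ⟨h.sublist (by simp), hs' _, ?_⟩
    rw [← List.cons_append, ← List.append_assoc, List.getLast?_concat]
  have hlt : arcCost w (p ++ b :: (β ++ [t])) < arcCost w (p ++ b :: (α ++ [t])) := by
    rw [arcCost_append_cons w p b (β ++ [t]), arcCost_append_cons w p b (α ++ [t])]
    linarith
  refine ⟨hP, hQ, hlt, polytopeAdj_of_diverge h hs fun heq => ?_⟩
  rw [hP.eq_of_arcVector_eq hQ heq] at hlt
  exact lt_irrefl _ hlt

/-- There is an `r`-chain from `x` to `y` with at least `L` steps. -/
def LongChain {α : Type*} (r : α → α → Prop) (L : ℕ) (x y : α) : Prop :=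
  ∃ p : RelSeries {q : α × α | r q.1 q.2}, p.head = x ∧ p.last = y ∧ L ≤ p.length

lemma LongChain.single {α : Type*} {r : α → α → Prop} {x y : α} (h : r x y) :
    LongChain r 1 x y :=
  ⟨⟨1, ![x, y], fun i => by obtain rfl := Subsingleton.elim i 0; exact h⟩, rfl, rfl, le_rfl⟩

lemma LongChain.mono {α : Type*} {r : α → α → Prop} {x y : α} {L L' : ℕ}
    (h : LongChain r L x y) (hL : L' ≤ L) : LongChain r L' x y := by
  obtain ⟨p, h1, h2, h3⟩ := h
  exact ⟨p, h1, h2, hL.trans h3⟩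

lemma LongChain.trans {α : Type*} {r : α → α → Prop} {x y z : α} {L L' : ℕ}
    (h : LongChain r L x y) (h' : LongChain r L' y z) : LongChain r (L + L') x z := by
  obtain ⟨p, h1, h2, h3⟩ := h
  obtain ⟨q, h1', h2', h3'⟩ := h'
  refine ⟨p.smash q (h2.trans h1'.symm), by simp [h1], by simp [h2'], ?_⟩
  simp only [RelSeries.smash_length]
  omega

/-- A chain of improving steps ending at the path of least weight gives a monotone path. -/
lemma LongChain.exists_isMonotonePath [Fintype V] {w : V → V → ℤ} {L : ℕ} {P O : List V}
    (h : LongChain (ImprovingStep s t w) L P O) (hO : IsPathList s t O)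
    (hopt : ∀ l, IsPathList s t l → l ≠ O → arcCost w O < arcCost w l) :
    ∃ (c : (PathArc s t → ℝ) →ₗ[ℝ] ℝ) (L' : ℕ) (v : Fin (L' + 1) → (PathArc s t → ℝ)),
      IsNondegenerateObjective (shortestPathPolytope s t) c ∧
      IsMonotonePath (shortestPathPolytope s t) c L' v ∧ L ≤ L' := by
  obtain ⟨c, hc⟩ := exists_objective s t w
  obtain ⟨p, -, hlast, hL⟩ := h
  have hlast' : p (Fin.last p.length) = O := hlast
  refine ⟨c, p.length, fun i => arcVector s t (p i), ?_, ⟨fun i => ?_, fun i => ?_, fun i => ?_, ?_⟩,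
    hL⟩
  · have hsub := extremePoints_convexHull_subset (𝕜 := ℝ)
      (A := arcVector s t '' {l | IsPathList s t l})
    rw [← shortestPathPolytope_eq] at hsub
    intro x hx y hy hxy
    obtain ⟨P, hP, rfl⟩ := hsub hx
    obtain ⟨Q, hQ, rfl⟩ := hsub hy
    rw [(hc P Q hP hQ).2 hxy]
  · refine Fin.lastCases ?_ (fun i => ?_) i
    · rw [hlast']
      exact arcVector_mem_extremePoints hO
    · exact (p.step i).2.2.2.1
  · exact (p.step i).2.2.2
  · exact (hc _ _ (p.step i).2.1 (p.step i).1).1 (p.step i).2.2.1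
  · intro x hx
    rw [hlast']
    rw [shortestPathPolytope_eq] at hx
    refine convexHull_min (t := {x | c (arcVector s t O) ≤ c x}) ?_
      (convex_halfSpace_ge c.isLinear (c (arcVector s t O))) hx
    rintro _ ⟨l, hl, rfl⟩
    by_cases h : l = O
    · subst h; exact le_refl (c _)
    · exact ((hc _ _ hO hl).1 (hopt l hl h)).le

end Objective

lemma nodup_append_cons_of {V : Type*} {p γ : List V} {b : V} (h : (p ++ [b]).Nodup)
    (hb : (b :: γ).Nodup) (hγ : ∀ x ∈ γ, x ∉ p) : (p ++ b :: γ).Nodup := by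
  rw [List.nodup_append] at h ⊢
  refine ⟨h.1, hb, fun x hx y hy => ?_⟩
  rcases List.mem_cons.1 hy with rfl | hy
  · exact h.2.2 x hx y (by simp)
  · rintro rfl
    exact hγ x hy hx

/-! ### Long chains of improving steps -/

section Chains

variable {V : Type*} [LinearOrder V] {s t : V}

/-- Weights for which the paths visiting alternately the nodes of `A` and the nodes
`U k, U (k - 1), …, U 0` can be traversed in lexicographic order. -/
structure LexWeights (t : V) (k : ℕ) (U : ℕ → V) (A : Finset V) (w : V → V → ℤ) : Prop where
  inj : ∀ i ≤ k, ∀ j ≤ k, U i = U j → i = j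
  notMem : ∀ i ≤ k, U i ∉ A
  ne : ∀ i ≤ k, U i ≠ t
  target_notMem : t ∉ A
  to_target : ∀ a ∈ A, w a t = 0
  to_node : ∀ a ∈ A, ∀ l < k, w a (U l) = 0
  node_to_target : ∀ l < k, w (U l) t < 0
  node_neg : ∀ l, l + 1 < k → ∀ a ∈ A, w (U (l + 1)) a < 0
  -- Together with the zero weights above, `next` makes the exchange of the tail `a, U l, t` for `b,
  -- t` after `U (l + 1)` improving; `close` does the same for going straight to `t`.
  next : ∀ l < k, ∀ a ∈ A, ∀ b ∈ A, a < b → w (U (l + 1)) b < w (U (l + 1)) a + w (U l) t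
  close : ∀ l < k, ∀ a ∈ A, w (U (l + 1)) t < w (U (l + 1)) a + w (U l) t

variable [Fintype V] {k : ℕ} {U : ℕ → V} {A : Finset V} {w : V → V → ℤ}

/-- Long chains that start with a path ending in a node of `A` and its arc to the target, and
end with the path that enters `U l` in between. -/
def HasLongChains (s t : V) (U : ℕ → V) (A : Finset V) (w : V → V → ℤ) (l : ℕ) : Prop :=
  ∀ (ρ : List V) (a : V) (B : Finset V), (ρ ++ [a]).head? = some s → (ρ ++ [a]).Nodup → a ∈ A →
    t ∉ ρ → (∀ i ≤ l, U i ∉ ρ) → B ⊆ A → (∀ x ∈ B, x ∉ ρ ++ [a]) →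
    LongChain (ImprovingStep s t w) (B.card.descFactorial l) (ρ ++ [a, t]) (ρ ++ [a, U l, t])

/-- One wheel of the odometer. Each node `a` of the list contributes a chain of level `l` using the
nodes of `B.erase a`; a single exchange then passes to the next node or, at the end of the list, to
`t`. These exchanges are dropped from the count. -/
lemma HasLongChains.loop (hw : LexWeights t k U A w) {l : ℕ} (hl : l < k)
    (h : HasLongChains s t U A w l) {σ : List V} {B : Finset V}
    (hs : (σ ++ [U (l + 1)]).head? = some s) (hσ : (σ ++ [U (l + 1)]).Nodup) (ht : t ∉ σ)
    (hU : ∀ i ≤ l, U i ∉ σ) (hB : B ⊆ A) (hBσ : ∀ x ∈ B, x ∉ σ) (L : List V) (a : V)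
    (hL : (a :: L).Pairwise (· < ·)) (hLB : ∀ x ∈ a :: L, x ∈ B) :
    LongChain (ImprovingStep s t w) ((L.length + 1) * (B.card - 1).descFactorial l)
      (σ ++ [U (l + 1), a, t]) (σ ++ [U (l + 1), t]) := by
  have hs' : ∀ γ : List V, (σ ++ U (l + 1) :: γ).head? = some s := by
    intro γ; cases σ <;> simpa using hs
  have hUne : U (l + 1) ≠ U l := fun h => by
    have := hw.inj _ (by omega) _ (by omega) h
    omega
  have hUt := hw.ne (l + 1) (by omega)
  have hUt' := hw.ne l (by omega)
  have hUA := hw.notMem (l + 1) (by omega)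
  have hUA' := hw.notMem l (by omega)
  have htA := hw.target_notMem
  have hUσ := hU l le_rfl
  have hsub : ∀ a ∈ B, LongChain (ImprovingStep s t w) ((B.card - 1).descFactorial l)
      (σ ++ [U (l + 1), a, t]) (σ ++ [U (l + 1), a, U l, t]) := by
    intro a ha
    have haA := hB ha
    have haσ := hBσ a ha
    have := h (σ ++ [U (l + 1)]) a (B.erase a) (by simpa using hs' [a])
      (by simp only [List.nodup_append, List.nodup_singleton] at hσ ⊢; grind) haA
      (by grind) (fun i hi => by
        have h1 : U i ≠ U (l + 1) := fun h => by
          have := hw.inj _ (by omega) _ (by omega) h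
          omega
        have := hU i hi
        grind) ((Finset.erase_subset _ _).trans hB) (fun x hx => by
        have hxB := Finset.mem_of_mem_erase hx
        have h1 := hBσ x hxB
        have h2 := hB hxB
        have h3 := Finset.ne_of_mem_erase hx
        grind)
    rw [Finset.card_erase_of_mem ha] at this
    simpa using this
  induction L generalizing a with
  | nil =>
    have ha := hLB a (by simp)
    have haA := hB ha
    have haσ := hBσ a ha
    refine ((hsub a ha).trans (.single
      (improvingStep_of_diverge (p := σ) (b := U (l + 1)) (α := [a, U l]) (β := [])
      ?_ hs ?_))).mono (by simp)
    · exact nodup_append_cons_of hσ (by simp; grind) (by simp; grind)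
    · have := hw.close l hl a haA
      simp [hw.to_node a haA l hl]
      linarith
  | cons a' L ih =>
    have ha := hLB a (by simp)
    have haA := hB ha
    have haσ := hBσ a ha
    have ha' := hLB a' (by simp)
    have haA' := hB ha'
    have haσ' := hBσ a' ha'
    have hlt : a < a' := List.rel_of_pairwise_cons hL (by simp)
    have hne := hlt.ne
    refine (((hsub a ha).trans (.single
      (improvingStep_of_diverge (p := σ) (b := U (l + 1)) (α := [a, U l]) (β := [a'])
      ?_ hs ?_))).trans (ih a' hL.of_cons fun x hx => hLB x (List.mem_cons_of_mem _ hx))).mono ?_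
    · clear ih hsub hL hs' hs
      exact nodup_append_cons_of hσ (by simp; grind) (by simp; grind)
    · have := hw.next l hl a haA a' haA' hlt
      simp [hw.to_node a haA l hl, hw.to_target a' haA']
      linarith
    · rw [List.length_cons]
      ring_nf
      omega

/-- Looping over all of `B` in increasing order gives `|B|` chains of the lower level, hence the
recursion of the falling factorial. -/
lemma HasLongChains.loop_sort (hw : LexWeights t k U A w) {l : ℕ} (hl : l < k)
    (h : HasLongChains s t U A w l) {σ : List V} {B : Finset V}
    (hs : (σ ++ [U (l + 1)]).head? = some s) (hσ : (σ ++ [U (l + 1)]).Nodup) (ht : t ∉ σ)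
    (hU : ∀ i ≤ l, U i ∉ σ) (hB : B ⊆ A) (hBσ : ∀ x ∈ B, x ∉ σ) (hne : B.Nonempty) :
    ∃ a ∈ B, LongChain (ImprovingStep s t w) (B.card.descFactorial (l + 1))
      (σ ++ [U (l + 1), a, t]) (σ ++ [U (l + 1), t]) := by
  obtain ⟨a, L, hL⟩ : ∃ a L, B.sort (· ≤ ·) = a :: L := by
    cases hB : B.sort (· ≤ ·) with
    | nil =>
      have := congrArg List.length hB
      simp [hne.ne_empty] at this
    | cons a L => exact ⟨a, L, rfl⟩
  have hmem : ∀ x ∈ a :: L, x ∈ B := fun x hx => by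
    rw [← hL] at hx
    simpa using hx
  have hlen : L.length + 1 = B.card := by
    rw [← List.length_cons (a := a), ← hL, Finset.length_sort]
  refine ⟨a, hmem a (by simp), ?_⟩
  have := h.loop hw hl hs hσ ht hU hB hBσ L a (hL ▸ B.sortedLT_sort.pairwise) hmem
  obtain ⟨m, hm⟩ : ∃ m, B.card = m + 1 := ⟨L.length, hlen.symm⟩
  rw [hlen, hm, Nat.add_sub_cancel, ← Nat.succ_descFactorial_succ, ← hm] at this
  exact this

lemma LexWeights.hasLongChains (hw : LexWeights t k U A w) (l : ℕ) (hl : l < k) :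
    HasLongChains s t U A w l := by
  induction l with
  | zero =>
    intro ρ a B hs hρ ha ht hU hB hBρ
    have hUρ := hU 0 le_rfl
    have hUA := hw.notMem 0 (by omega)
    have hUt := hw.ne 0 (by omega)
    have htA := hw.target_notMem
    refine (LongChain.single
      (improvingStep_of_diverge (p := ρ) (b := a) (α := []) (β := [U 0]) ?_ hs ?_)).mono (by simp)
    · exact nodup_append_cons_of hρ (by simp; grind) (by simp; grind)
    · have := hw.node_to_target 0 hl
      simpa [hw.to_node a ha 0 hl, hw.to_target a ha] using this
  | succ l ih =>
    intro ρ a B hs hρ ha ht hU hB hBρ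
    have hUρ := hU (l + 1) le_rfl
    have hUA := hw.notMem (l + 1) (by omega)
    have hUt := hw.ne (l + 1) (by omega)
    have htA := hw.target_notMem
    have hs' : ∀ γ : List V, (ρ ++ a :: γ).head? = some s := by
      intro γ; cases ρ <;> simpa using hs
    rcases B.eq_empty_or_nonempty with rfl | hne
    -- Here the falling factorial is zero; only the correct endpoint is needed.
    · refine (LongChain.single (improvingStep_of_diverge (p := ρ) (b := a) (α := [])
        (β := [U (l + 1)]) ?_ hs ?_)).mono (by simp)
      · exact nodup_append_cons_of hρ (by simp; grind) (by simp; grind)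
      · have := hw.node_to_target (l + 1) hl
        simpa [hw.to_node a ha (l + 1) hl, hw.to_target a ha] using this
    · obtain ⟨b, hb, hc⟩ := (ih (by omega)).loop_sort hw (by omega) (σ := ρ ++ [a]) (B := B)
        (by simpa using hs' [U (l + 1)])
        (by simp only [List.nodup_append, List.nodup_singleton] at hρ ⊢; grind)
        (by grind)
        (fun i hi => by
          have h1 := hU i (by omega)
          have h2 := hw.notMem i (by omega)
          grind) hB hBρ hne
      have hbA := hB hb
      have hbρ := hBρ b hb
      -- The hub is entered together with the first node `b` of the loop, because the tail `U (l +
      -- 1), t` is where the loop ends.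
      refine ((LongChain.single (improvingStep_of_diverge (p := ρ) (b := a) (α := [])
        (β := [U (l + 1), b]) ?_ hs ?_)).trans (by simpa using hc)).mono (Nat.le_add_left _ 1)
      · exact nodup_append_cons_of hρ (by simp; grind) (by simp; grind)
      · have := hw.node_neg l hl b hbA
        simp [hw.to_node a ha (l + 1) hl, hw.to_target a ha, hw.to_target b hbA]
        linarith

end Chains

/-! ### Weights on the complete graph with nodes `0, …, n - 1` -/

section Weights

/-- The weights that make the lexicographic traversal improving: nodes `0, …, k` are the nodes
`U k, …, U 0`, the last node is the target. -/
def lexWeight (n k : ℕ) (x y : Fin n) : ℤ :=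
  if (y : ℕ) = n - 1 then
    if (x : ℕ) = 0 then -(2 * n * (2 * n + 2) ^ (k + 1)) - 1
    else if (x : ℕ) ≤ k then -(2 * n + 2) ^ (k - x)
    else 0
  -- With `x = U (l + 1)` and base `2n + 2`, this is `-2 y (2n + 2) ^ l`. Raising `y` by one gains
  -- more than the `(2n + 2) ^ l` lost with the arc from `U l` to the target, and `(2y + 1) (2n + 2)
  -- ^ l` stays below `(2n + 2) ^ (l + 1)`.
  else if (x : ℕ) < k ∧ k < (y : ℕ) then -(2 * (2 * n + 2) ^ (k - x - 1) * y)
  else 0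

/-- The intermediate nodes with a large number. -/
def lexNodes (n k : ℕ) : Finset (Fin n) := {a | k < (a : ℕ) ∧ (a : ℕ) < n - 1}

lemma card_lexNodes (n k : ℕ) : (lexNodes n k).card = n - 2 - k := by
  have h : (lexNodes n k).map Fin.valEmbedding = Finset.Ioo k (n - 1) := by
    ext a
    simp only [lexNodes, Finset.mem_map, Finset.mem_filter, Finset.mem_univ, true_and,
      Fin.valEmbedding_apply, Finset.mem_Ioo]
    constructor
    · rintro ⟨b, hb, rfl⟩
      exact hb
    · intro h
      exact ⟨⟨a, by omega⟩, h, rfl⟩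
  rw [← Finset.card_map Fin.valEmbedding, h, Nat.card_Ioo]
  omega

lemma lexWeight_ge {n k : ℕ} {x y : Fin n} (h : (x : ℕ) ≠ 0 ∨ (y : ℕ) ≠ n - 1) :
    -(2 * n + 2) ^ (k + 1) ≤ lexWeight n k x y := by
  have hB : (1 : ℤ) ≤ 2 * n + 2 := by omega
  have h1 : ∀ m ≤ k, (2 * (n : ℤ) + 2) ^ m ≤ (2 * n + 2) ^ k := fun m hm =>
    pow_le_pow_right₀ hB hm
  have h2 : (2 * (n : ℤ) + 2) ^ (k + 1) = (2 * n + 2) ^ k * (2 * n + 2) := pow_succ _ _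
  have h3 : (0 : ℤ) < (2 * n + 2) ^ k := by positivity
  have hy := y.2
  unfold lexWeight
  split_ifs with c1 c2 c3 c4
  · omega
  · have := h1 (k - x) (by omega)
    nlinarith
  · nlinarith
  · have h4 := h1 (k - x - 1) (by omega)
    have h5 : (0 : ℤ) < (2 * n + 2) ^ (k - x - 1 : ℕ) := by positivity
    have h6 : ((y : ℕ) : ℤ) ≤ n := by exact_mod_cast hy.le
    have h7 := mul_le_mul h4 h6 (by positivity) h3.le
    nlinarith
  · nlinarith

lemma arcCost_ge {V : Type*} {w : V → V → ℤ} {W : ℤ} (hW : 0 ≤ W) {l : List V}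
    (h : ∀ e ∈ l.arcs, -W ≤ w e.1 e.2) : -(l.length * W) ≤ arcCost w l := by
  have h1 : ∀ L : List (V × V), (∀ e ∈ L, -W ≤ w e.1 e.2) →
      -(L.length * W) ≤ (L.map fun e => w e.1 e.2).sum := by
    intro L hL
    induction L with
    | nil => simp
    | cons e L ih =>
      have h2 := hL e (by simp)
      have h3 := ih fun e he => hL e (by simp [he])
      simp only [List.length_cons, List.map_cons, List.sum_cons]
      push_cast
      linarith
  have h2 := h1 _ h
  have h3 : (l.arcs.length : ℤ) * W ≤ l.length * W :=
    mul_le_mul_of_nonneg_right (by exact_mod_cast l.length_arcs_le) hW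
  exact (neg_le_neg h3).trans h2

lemma IsPathList.eq_pair {V : Type*} {s t : V} {l : List V} (hl : IsPathList s t l)
    (h : (s, t) ∈ l.arcs) : l = [s, t] := by
  obtain ⟨h1, h2, h3⟩ := hl
  match l with
  | [] => simp at h
  | [x] => simp at h
  | x :: y :: l =>
    obtain rfl : x = s := by simpa using h2
    obtain rfl : y = t := h1.arcs_functional (x := x) (by simp) h
    rw [(isPathList_cons ⟨h1, h2, h3⟩).eq_singleton]

variable {n k : ℕ} {s t : Fin n}

/-- Any other path avoids the direct arc and has at most `n` arcs, each of weight at least `-(2n +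
2) ^ (k + 1)`. -/
lemma lexWeight_optimal (hn : 2 ≤ n) (hs : (s : ℕ) = 0) (ht : (t : ℕ) = n - 1) {l : List (Fin n)}
    (hl : IsPathList s t l) (hne : l ≠ [s, t]) :
    arcCost (lexWeight n k) [s, t] < arcCost (lexWeight n k) l := by
  have h1 : arcCost (lexWeight n k) [s, t] = -(2 * n * (2 * n + 2) ^ (k + 1)) - 1 := by
    simp [lexWeight, hs, ht]
  have h2 : (0 : ℤ) < (2 * n + 2) ^ (k + 1) := by positivity
  have h3 := arcCost_ge (w := lexWeight n k) h2.le (l := l) fun e he => by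
    refine lexWeight_ge ?_
    by_contra! hc
    have h4 : e = (s, t) := Prod.ext (Fin.ext (hc.1.trans hs.symm)) (Fin.ext (hc.2.trans ht.symm))
    exact hne (hl.eq_pair (h4 ▸ he))
  have h4 : (l.length : ℤ) ≤ n := by exact_mod_cast (by simpa using hl.nodup.length_le_card)
  have h5 := mul_le_mul_of_nonneg_right h4 h2.le
  have h6 : 0 ≤ (n : ℤ) * (2 * n + 2) ^ (k + 1) := by positivity
  rw [h1]
  linarith

lemma lexWeights (hk : k + 3 ≤ n) (ht : (t : ℕ) = n - 1) :
    LexWeights t k (fun l => (⟨k - l, by omega⟩ : Fin n)) (lexNodes n k) (lexWeight n k) where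
  inj i hi j hj h := by
    have := congrArg Fin.val h
    simp only at this
    omega
  notMem i hi := by simp [lexNodes]
  ne i hi h := by
    have := congrArg Fin.val h
    simp only at this
    omega
  target_notMem := by simp [lexNodes, ht]
  to_target a ha := by
    simp only [lexNodes, Finset.mem_filter, Finset.mem_univ, true_and] at ha
    unfold lexWeight
    rw [if_pos ht, if_neg (by omega), if_neg (by omega)]
  to_node a ha l hl := by
    simp only [lexNodes, Finset.mem_filter, Finset.mem_univ, true_and] at ha
    unfold lexWeight
    rw [if_neg (by simp only; omega), if_neg (by omega)]
  node_to_target l hl := by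
    unfold lexWeight
    rw [if_pos ht, if_neg (by simp only; omega), if_pos (by simp)]
    have : (0 : ℤ) < (2 * n + 2) ^ (k - (k - l)) := by positivity
    linarith
  node_neg l hl a ha := by
    simp only [lexNodes, Finset.mem_filter, Finset.mem_univ, true_and] at ha
    unfold lexWeight
    rw [if_neg (by omega), if_pos (by simp only; omega)]
    have h1 : (0 : ℤ) < (a : ℕ) := by omega
    have : (0 : ℤ) < 2 * (2 * n + 2) ^ (k - (k - (l + 1)) - 1) * (a : ℕ) := by positivity
    linarith
  next l hl a ha b hb hab := by
    simp only [lexNodes, Finset.mem_filter, Finset.mem_univ, true_and] at ha hb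
    unfold lexWeight
    rw [if_neg (by omega), if_pos (by simp only; omega), if_neg (by omega),
      if_pos (by simp only; omega), if_pos ht, if_neg (by simp only; omega), if_pos (by simp)]
    simp only
    rw [show k - (k - (l + 1)) - 1 = l by omega, show k - (k - l) = l by omega]
    have h1 : (0 : ℤ) < (2 * n + 2) ^ l := by positivity
    have h2 : ((a : ℕ) : ℤ) + 1 ≤ (b : ℕ) := by exact_mod_cast hab
    nlinarith
  close l hl a ha := by
    simp only [lexNodes, Finset.mem_filter, Finset.mem_univ, true_and] at ha
    unfold lexWeight
    rw [if_neg (show ¬ (a : ℕ) = n - 1 by omega), if_pos ht, if_pos ht,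
      if_neg (show ¬ k - l = 0 by omega), if_pos (show k - l ≤ k by omega),
      if_pos (show k - (l + 1) < k ∧ k < (a : ℕ) by omega)]
    rw [show k - (k - (l + 1)) - 1 = l by omega, show k - (k - l) = l by omega]
    have h1 : (0 : ℤ) < (2 * n + 2) ^ l := by positivity
    have h2 : ((a : ℕ) : ℤ) + 1 ≤ n := by exact_mod_cast a.2
    have h3 : (2 * (n : ℤ) + 2) ^ (l + 1) = (2 * n + 2) ^ l * (2 * n + 2) := pow_succ _ _
    -- In the case `c1` the hub `U (l + 1)` is the source, whose arc to the target has the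
    -- exceptional weight.
    split_ifs with c1 c2
    · have h4 : (2 * (n : ℤ) + 2) ^ (l + 1) ≤ (2 * n + 2) ^ (k + 1) :=
        pow_le_pow_right₀ (by omega) (by omega)
      have h5 : (2 * (n : ℤ) + 2) ^ (k + 1) ≤ n * (2 * n + 2) ^ (k + 1) :=
        le_mul_of_one_le_left (by positivity) (by omega)
      have h6 := mul_le_mul_of_nonneg_left h2 h1.le
      have h7 : (0 : ℤ) < (2 * n + 2) ^ (k + 1) := by positivity
      linarith
    · rw [show k - (k - (l + 1)) = l + 1 by omega]
      nlinarith
    · exact absurd (Nat.sub_le _ _) c2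

/-- Long chains of improving steps that end at the arc from the source to the target. -/
lemma exists_longChain (hk : k + 3 ≤ n) (hs : (s : ℕ) = 0) (ht : (t : ℕ) = n - 1) :
    ∃ P, LongChain (ImprovingStep s t (lexWeight n k)) ((n - 2 - k).descFactorial k) P [s, t] := by
  have hst : s ≠ t := fun h => by
    have := congrArg Fin.val h
    omega
  have hw := lexWeights hk ht
  obtain _ | l := k
  · let a : Fin n := ⟨1, by omega⟩
    have hsa : s ≠ a := fun h => by
      have := congrArg Fin.val h
      simp only [a] at this
      omega
    have hat : a ≠ t := fun h => by
      have := congrArg Fin.val h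
      simp only [a] at this
      omega
    have hpair : IsPathList s t [s, t] := ⟨by simp [hst], rfl, by simp⟩
    have htriple : IsPathList s t [s, a, t] :=
      ⟨by simp [hst, hsa, hat], rfl, by simp⟩
    refine ⟨_, (LongChain.single (improvingStep_of_diverge (p := []) (b := s) (α := [a]) (β := [])
      (by simp [hst, hsa, hat]) rfl ?_)).mono (by simp)⟩
    exact lexWeight_optimal (by omega) hs ht htriple (by simp)
  · have hU : (⟨l + 1 - (l + 1), by omega⟩ : Fin n) = s := Fin.ext (by simp [hs])
    have hne : (lexNodes n (l + 1)).Nonempty := by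
      rw [← Finset.card_pos, card_lexNodes]
      omega
    -- At the top level the hub is the source and the prefix is empty, so the loop ends at the
    -- direct arc.
    obtain ⟨a, -, h⟩ := (hw.hasLongChains (s := s) l (Nat.lt_succ_self l)).loop_sort hw
      (Nat.lt_succ_self l) (σ := []) (B := lexNodes n (l + 1)) (by simpa using hU) (by simp) (by simp)
      (by simp) subset_rfl (by simp) hne
    rw [card_lexNodes] at h
    simp only [hU, List.nil_append] at h
    exact ⟨_, h⟩

end Weights

/-! ### The size of the number of steps -/

/-- Consecutive values of `(2k)! / k!` have ratio `4k + 2`, and `(3k + 3) (3k + 2) (3k + 1) ≤ (4k +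
2) ^ 3`. -/
lemma factorial_three_mul_le (k : ℕ) : (3 * k).factorial ≤ ((2 * k).descFactorial k) ^ 3 := by
  induction k with
  | zero => simp
  | succ k ih =>
    have h1 : (2 * (k + 1)).descFactorial (k + 1) = (4 * k + 2) * (2 * k).descFactorial k := by
      have e1 := Nat.factorial_mul_descFactorial (show k + 1 ≤ 2 * (k + 1) by omega)
      have e2 := Nat.factorial_mul_descFactorial (show k ≤ 2 * k by omega)
      rw [show 2 * (k + 1) - (k + 1) = k + 1 by omega, show 2 * (k + 1) = 2 * k + 1 + 1 by ring,
        Nat.factorial_succ (2 * k + 1), Nat.factorial_succ (2 * k), Nat.factorial_succ k, ← e2,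
        show 2 * k - k = k by omega] at e1
      rw [show 2 * (k + 1) = 2 * k + 1 + 1 by ring]
      have h2 : 0 < (k + 1) * k.factorial := by positivity
      refine Nat.eq_of_mul_eq_mul_left h2 (e1.trans ?_)
      ring
    rw [h1, mul_pow, show 3 * (k + 1) = 3 * k + 2 + 1 by ring, Nat.factorial_succ,
      Nat.factorial_succ, Nat.factorial_succ]
    have h2 : (3 * k + 2 + 1) * (3 * k + 1 + 1) * (3 * k + 1) ≤ (4 * k + 2) ^ 3 := by
      nlinarith [sq_nonneg k, mul_nonneg (Nat.zero_le k) (sq_nonneg k)]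
    calc _ = (3 * k + 2 + 1) * (3 * k + 1 + 1) * (3 * k + 1) * (3 * k).factorial := by ring
      _ ≤ _ := Nat.mul_le_mul h2 ih

/-- At most four factors, each at most `n`, separate `(3k)!` from `n!`; the bound `n ^ 6` is
generous. -/
lemma factorial_le_of_three_mul {n k : ℕ} (hn : 0 < n) (h1 : 3 * k ≤ n) (h2 : n ≤ 3 * k + 4) :
    n.factorial ≤ ((2 * k).descFactorial k * n ^ 2) ^ 3 := by
  have h3 : n.factorial = (n - (n - 3 * k)).factorial * n.descFactorial (n - 3 * k) :=
    (Nat.factorial_mul_descFactorial (by omega)).symm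
  rw [h3, show n - (n - 3 * k) = 3 * k by omega, mul_pow]
  refine Nat.mul_le_mul (factorial_three_mul_le k) ((Nat.descFactorial_le_pow _ _).trans ?_)
  rw [← pow_mul]
  exact Nat.pow_le_pow_right hn (by omega)

theorem mainTheorem7 :
    ∃ C : ℝ, 0 < C ∧ ∀ (n : ℕ) (_hn : 3 ≤ n) (s t : Fin n)
      (_hs : (s : ℕ) = 0) (_ht : (t : ℕ) = n - 1),
      ∃ (c : (PathArc s t → ℝ) →ₗ[ℝ] ℝ) (L : ℕ) (v : Fin (L + 1) → (PathArc s t → ℝ)),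
        IsNondegenerateObjective (shortestPathPolytope s t) c ∧
        IsMonotonePath (shortestPathPolytope s t) c L v ∧
        C / (n : ℝ) ^ 2 * ((n.factorial : ℝ) ^ (1 / 3 : ℝ)) < (L : ℝ) := by
  -- The factor `1 / 2` serves only to make the final inequality strict.
  refine ⟨1 / 2, by norm_num, fun n hn s t hs ht => ?_⟩
  -- The lower bound on `n` gives `n - 2 - k ≥ 2k`; the upper bound keeps `n!` close to `(3k)!`.
  obtain ⟨k, hk1, hk2⟩ : ∃ k, 3 * k + 2 ≤ n ∧ n ≤ 3 * k + 4 := ⟨(n - 2) / 3, by omega, by omega⟩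
  have hst : s ≠ t := fun h => by
    have := congrArg Fin.val h
    omega
  obtain ⟨P, hP⟩ := exists_longChain (k := k) (by omega) hs ht
  obtain ⟨c, L, v, hc, hv, hL⟩ := hP.exists_isMonotonePath ⟨by simp [hst], rfl, by simp⟩
    fun l hl hne => lexWeight_optimal (by omega) hs ht hl hne
  refine ⟨c, L, v, hc, hv, ?_⟩
  have hD : (2 * k).descFactorial k ≤ L :=
    (Nat.descFactorial_le _ (by omega)).trans hL
  have hpos : 0 < (2 * k).descFactorial k := Nat.descFactorial_pos.2 (by omega)
  have hn0 : (0 : ℝ) < n := by exact_mod_cast (by omega : 0 < n)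
  have hroot : (n.factorial : ℝ) ^ (1 / 3 : ℝ) ≤ (2 * k).descFactorial k * (n : ℝ) ^ 2 := by
    have h1 : (n.factorial : ℝ) ≤ ((2 * k).descFactorial k * (n : ℝ) ^ 2) ^ 3 := by
      exact_mod_cast factorial_le_of_three_mul (by omega) (by omega) hk2
    calc (n.factorial : ℝ) ^ (1 / 3 : ℝ)
        ≤ (((2 * k).descFactorial k * (n : ℝ) ^ 2) ^ 3) ^ (1 / 3 : ℝ) :=
          Real.rpow_le_rpow (by positivity) h1 (by norm_num)
      _ = _ := by
          have h2 := Real.pow_rpow_inv_natCast (n := 3)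
            (x := (2 * k).descFactorial k * (n : ℝ) ^ 2) (by positivity) (by norm_num)
          rwa [Nat.cast_ofNat, ← one_div] at h2
  have hD' : (((2 * k).descFactorial k : ℕ) : ℝ) ≤ L := by exact_mod_cast hD
  have hpos' : (0 : ℝ) < ((2 * k).descFactorial k : ℕ) := by exact_mod_cast hpos
  calc 1 / 2 / (n : ℝ) ^ 2 * (n.factorial : ℝ) ^ (1 / 3 : ℝ)
      ≤ 1 / 2 / (n : ℝ) ^ 2 * ((2 * k).descFactorial k * (n : ℝ) ^ 2) :=
        mul_le_mul_of_nonneg_left hroot (by positivity)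
    _ = 1 / 2 * (2 * k).descFactorial k := by field_simp
    _ < L := by linarith
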